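/- Let $G$ be a finite simple graph with vertex set $V(G)$ and edge set $E(G)$. Let $P(G)$ be the set of all functions (valuations) $f:E(G)\to(0,\infty)$ with $\sum_{e\in E(G)}f(e)=|E(G)|$. Let $T(G)$ be the set of all $f\in P(G)$ with $\sum_{e\ni v}f(e)=\deg v$ for every $v\in V(G)$, and let $C(G)$ be the set of all $f\in P(G)$ for which there is $g:V(G)\to(0,\infty)$ with $f(vw)=g(v)+g(w)$ for every edge $vw$. For $f\in P(G)$ put $$\tau(G)_f=\sum_{S}\ \prod_{k\in E(S)}f(k),$$ where $S$ runs over all spanning trees of $G$, and for $e\in E(G)$ let $$\tau(e)=\frac{\partial\tau(G)_f}{\partial f(e)}=\sum_{S\,:\,e\in E(S)}\ \prod_{k\in E(S),\,k\neq e}f(k).$$ Then: (1) A valuation $f\in T(G)$ maximizes $\tau(G)_f$ over $T(G)$ if and only if there are constants $\lambda_v\in\mathbb{R}$, $v\in V(G)$, such that $\tau(e)=\lambda_v+\lambda_w$ for every edge $e=vw$ of $G$. (2) A valuation $f\in C(G)$ maximizes $\tau(G)_f$ over $C(G)$ if and only if for all vertices $v,w\in V(G)$ $$\deg w\sum_{e\ni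 v}\tau(e)=\deg v\sum_{e\ni w}\tau(e).$$ -/

import Mathlib

namespace EdgeValuation

variable {V : Type*} [Fintype V] [DecidableEq V] (G : SimpleGraph V) [DecidableRel G.Adj]

/-- The set `P(G)` of positive edge valuations of total weight `|E(G)|`. -/
def P : Set (G.edgeSet → ℝ) :=
  {f | (∀ e, 0 < f e) ∧ ∑ e, f e = (G.edgeFinset.card : ℝ)}

/-- The set `T(G)` of valuations in `P(G)` for which, at each vertex, the weights of the
incident edges add up to the degree of the vertex. -/
def T : Set (G.edgeSet → ℝ) :=
  {f | f ∈ P G ∧ ∀ v : V, ∑ e : G.edgeSet with v ∈ e.1, f e = (G.degree v : ℝ)}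

/-- The set `C(G)` of valuations in `P(G)` induced by a positive function on the vertices. -/
def C : Set (G.edgeSet → ℝ) :=
  {f | f ∈ P G ∧ ∃ g : V → ℝ, (∀ v, 0 < g v) ∧
    ∀ (v w : V) (h : G.Adj v w), f ⟨s(v, w), h⟩ = g v + g w}

open Classical in
/-- The finite set of spanning trees of `G`: subgraphs on the whole vertex set which are trees. -/
noncomputable def spanningTrees : Finset (SimpleGraph V) :=
  {S : SimpleGraph V | S ≤ G ∧ S.IsTree}

open Classical in
/-- The weighted number of spanning trees `τ(G)_f`, the sum over all spanning trees of the
product of the weights of their edges. -/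
noncomputable def treeNumber (f : G.edgeSet → ℝ) : ℝ :=
  ∑ S ∈ spanningTrees G, ∏ e : G.edgeSet with e.1 ∈ S.edgeSet, f e

open Classical in
/-- The quantity `τ(e)` at `f`, which is the partial derivative of `treeNumber G` in the
coordinate `e`: the sum over all spanning trees containing `e` of the product of the weights of
their edges other than `e`. -/
noncomputable def edgeTreeNumber (f : G.edgeSet → ℝ) (e : G.edgeSet) : ℝ :=
  ∑ S ∈ spanningTrees G with e.1 ∈ S.edgeSet,
    ∏ k : G.edgeSet with k.1 ∈ S.edgeSet ∧ k ≠ e, f k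

end EdgeValuation

/-! By the weighted matrix-tree theorem `det_reducedLaplacian`, the tree number is the determinant
of a positive semidefinite matrix depending linearly on the weights. The determinant is log-concave
on such matrices, so a valuation maximizes over a convex set as soon as the derivative vanishes
towards every point of it (`treeNumber_le_of_critical`). Both sets of valuations are cut out of an
affine space by positivity, an open condition, so conversely a maximizer is critical in every
admissible direction (`critical_of_isMaxOn`). It remains to see when the gradient, whose coordinates
are the `edgeTreeNumber`s, annihilates these directions: for `T` they are the edge vectors with zero
sum at every vertex, for `C` those induced by vertex functions orthogonal to the degrees. -/

namespace EdgeValuation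

/-! ### Cauchy–Binet -/

open Matrix Polynomial in
/-- A form of the **Cauchy–Binet formula**. -/
theorem det_mul_eq_sum_minors {m n R : Type*} [CommRing R] [Fintype m] [DecidableEq m]
    [Fintype n] [DecidableEq n] (A : Matrix m n R) (B : Matrix n m R) :
    (A * B).det = ∑ s ∈ Finset.univ.powersetCard (Fintype.card m),
      ((B * A).submatrix (Subtype.val : s → n) (Subtype.val : s → n)).det := by
  -- Compare the coefficients of `X ^ |m|` in `det (1 + X A B) = det (1 + X B A)`; for `A * B` the
  -- only principal minor of that size is the full determinant.
  have h1 := coeff_det_one_add_X_smul_eq_sum_minors (A * B) (Fintype.card m)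
  rw [← Finset.card_univ, Finset.powersetCard_self, Finset.sum_singleton] at h1
  let e : ↥(Finset.univ : Finset m) ≃ m := Equiv.subtypeUnivEquiv fun x => Finset.mem_univ x
  have h2 : ((A * B).submatrix e e).det = (A * B).det := det_submatrix_equiv_self e (A * B)
  rw [← h2, show ((A * B).submatrix e e).det = _ from h1.symm, Finset.card_univ]
  rw [← coeff_det_one_add_X_smul_eq_sum_minors (B * A)]
  rw [Matrix.map_mul, Matrix.map_mul, ← Matrix.smul_mul, det_one_add_mul_comm, Matrix.mul_smul]

/-! ### Minors of the incidence matrix -/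

variable {V : Type*} [DecidableEq V] (G : SimpleGraph V)

/-- The signed incidence matrix of `G`, for an arbitrary orientation of the edges, with the
column of the vertex `r` removed. -/
noncomputable def reducedIncidence (r : V) : Matrix G.edgeSet {v // v ≠ r} ℤ :=
  fun e u => (if (Quot.out e.1).1 = u then 1 else 0) - (if (Quot.out e.1).2 = u then 1 else 0)

/-- The unit vector at `w`, restricted to the vertices different from `r`. -/
def reducedSingle (r w : V) : {v // v ≠ r} → ℤ := fun u => if w = u then 1 else 0

theorem reducedIncidence_row {r w w' : V} (h : G.Adj w w') :
    reducedIncidence G r ⟨s(w, w'), h⟩ = reducedSingle r w - reducedSingle r w' ∨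
    reducedIncidence G r ⟨s(w, w'), h⟩ = -(reducedSingle r w - reducedSingle r w') := by
  have h1 : s((Quot.out s(w, w')).1, (Quot.out s(w, w')).2) = s(w, w') := Quot.out_eq _
  rcases Sym2.eq_iff.1 h1 with ⟨ha, hb⟩ | ⟨ha, hb⟩
  · left
    funext u
    simp only [reducedIncidence, reducedSingle, Pi.sub_apply, ha, hb]
  · right
    funext u
    simp only [reducedIncidence, reducedSingle, Pi.sub_apply, Pi.neg_apply, ha, hb]
    ring

/-- Along a walk from `w` to `r` the signed rows telescope to the unit vector at `w`. Working over
`ℤ` makes a square matrix with such an inverse have determinant `±1`. -/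
theorem exists_mul_reducedIncidence_eq_one (r : V) (s : Finset G.edgeSet)
    (hs : (SimpleGraph.fromEdgeSet (Subtype.val '' (s : Set G.edgeSet))).Connected) :
    ∃ M : Matrix {v // v ≠ r} s ℤ,
      M * (reducedIncidence G r).submatrix (Subtype.val : s → G.edgeSet) id = 1 := by
  set B := (reducedIncidence G r).submatrix (Subtype.val : s → G.edgeSet) id with hB
  have key : ∀ w, reducedSingle r w ∈ Submodule.span ℤ (Set.range B) := by
    intro w
    obtain ⟨p⟩ := hs.preconnected w r
    induction p with
    | nil =>
      convert Submodule.zero_mem _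
      funext u
      exact if_neg u.2.symm
    | @cons a b c hab p ih =>
      rw [SimpleGraph.fromEdgeSet_adj] at hab
      obtain ⟨⟨e, he, hee⟩, hne⟩ := hab
      have hadj : G.Adj a b := by
        have := e.2
        rwa [hee] at this
      obtain rfl : e = ⟨s(a, b), hadj⟩ := Subtype.ext hee
      have h1 : B ⟨_, he⟩ ∈ Submodule.span ℤ (Set.range B) :=
        Submodule.subset_span ⟨_, rfl⟩
      have h2 : B ⟨_, he⟩ = reducedIncidence G c ⟨s(a, b), hadj⟩ := rfl
      have h3 := ih hB
      rw [h2] at h1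
      rcases reducedIncidence_row G (r := c) hadj with h | h
      · rw [h] at h1
        simpa using add_mem h1 h3
      · rw [h, neg_mem_iff] at h1
        simpa using add_mem h1 h3
  choose c hc using fun w => (Submodule.mem_span_range_iff_exists_fun ℤ).1 (key w)
  refine ⟨Matrix.of fun w => c w, ?_⟩
  ext w u
  have := congrFun (hc w) u
  simp only [Finset.sum_apply, Pi.smul_apply, smul_eq_mul, reducedSingle] at this
  rw [Matrix.mul_apply, Matrix.one_apply]
  simp only [Matrix.of_apply, this, Subtype.ext_iff]

variable [Fintype V]

theorem sum_reducedSingle_mul (r w : V) (X : V → ℤ) (hX : X r = 0) :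
    ∑ u, reducedSingle r w u * X u.1 = X w := by
  by_cases hw : w = r
  · subst hw
    rw [hX]
    refine Finset.sum_eq_zero fun u _ => ?_
    rw [reducedSingle, if_neg u.2.symm, zero_mul]
  · rw [Finset.sum_eq_single ⟨w, hw⟩]
    · simp [reducedSingle]
    · intro u _ hu
      rw [reducedSingle, if_neg, zero_mul]
      rintro rfl
      exact hu rfl
    · simp

/-- The indicator of the vertices not reachable from `r` takes equal values at the ends of each edge
of `s`. -/
theorem exists_reducedIncidence_mulVec_eq_zero (r : V) (s : Finset G.edgeSet)
    (hs : ¬ (SimpleGraph.fromEdgeSet (Subtype.val '' (s : Set G.edgeSet))).Connected) :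
    ∃ x : {v // v ≠ r} → ℤ, x ≠ 0 ∧
      ((reducedIncidence G r).submatrix (Subtype.val : s → G.edgeSet) id).mulVec x = 0 := by
  classical
  set H := SimpleGraph.fromEdgeSet (Subtype.val '' (s : Set G.edgeSet)) with hH
  rw [SimpleGraph.connected_iff_exists_forall_reachable] at hs
  push Not at hs
  obtain ⟨w, hw⟩ := hs r
  set X : V → ℤ := fun v => if H.Reachable r v then 0 else 1 with hX
  have hXr : X r = 0 := if_pos (SimpleGraph.Reachable.refl r)
  refine ⟨fun v => X v, ?_, ?_⟩
  · intro h0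
    have hwr : w ≠ r := by
      rintro rfl
      exact hw (SimpleGraph.Reachable.refl _)
    have := congrFun h0 ⟨w, hwr⟩
    simp [hX, hw] at this
  · funext ⟨⟨e, heG⟩, he⟩
    induction e with
    | _ a b =>
      have hadj : G.Adj a b := heG
      have hHadj : H.Adj a b := by
        rw [hH, SimpleGraph.fromEdgeSet_adj]
        exact ⟨⟨_, he, rfl⟩, hadj.ne⟩
      have hab : X a = X b := by
        have : H.Reachable r a ↔ H.Reachable r b :=
          ⟨fun h => h.trans hHadj.reachable, fun h => h.trans hHadj.symm.reachable⟩
        simp only [hX, this]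
      have hsum : ∑ u : {v // v ≠ r}, (reducedSingle r a - reducedSingle r b) u * X u = 0 := by
        simp only [Pi.sub_apply, sub_mul, Finset.sum_sub_distrib, sum_reducedSingle_mul r _ X hXr,
          hab, sub_self]
      change ∑ u : {v // v ≠ r}, reducedIncidence G r ⟨s(a, b), hadj⟩ u * X u = 0
      rcases reducedIncidence_row G (r := r) hadj with h | h
      · rw [h, hsum]
      · rw [h]
        simp only [Pi.neg_apply, neg_mul, Finset.sum_neg_distrib, hsum, neg_zero]

open Classical in
theorem det_reducedIncidence_mul_transpose (r : V) (s : Finset G.edgeSet)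
    (hs : s.card = Fintype.card {v // v ≠ r}) :
    ((reducedIncidence G r * (reducedIncidence G r).transpose).submatrix
      (Subtype.val : s → G.edgeSet) (Subtype.val : s → G.edgeSet)).det =
    if (SimpleGraph.fromEdgeSet (Subtype.val '' (s : Set G.edgeSet))).Connected then 1 else 0 := by
  have e : s ≃ {v // v ≠ r} := Fintype.equivOfCardEq (by simpa using hs)
  set B := (reducedIncidence G r).submatrix (Subtype.val : s → G.edgeSet) id with hB
  set N := B.submatrix id e with hN
  have h1 : (reducedIncidence G r * (reducedIncidence G r).transpose).submatrix
      (Subtype.val : s → G.edgeSet) (Subtype.val : s → G.edgeSet) = N * N.transpose := by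
    rw [hN, Matrix.transpose_submatrix, Matrix.submatrix_mul_equiv, hB]
    rfl
  rw [h1, Matrix.det_mul, Matrix.det_transpose]
  split_ifs with hc
  · obtain ⟨M, hM⟩ := exists_mul_reducedIncidence_eq_one G r s hc
    have h2 : M.submatrix e id * N = 1 := by
      have := congrArg (fun A => A.submatrix e e) hM
      simpa [hN, hB, Matrix.submatrix_mul _ _ e id e Function.bijective_id] using this
    have h3 : IsUnit N.det := by
      have := congrArg Matrix.det h2
      rw [Matrix.det_mul, Matrix.det_one] at this
      exact IsUnit.of_mul_eq_one_right _ this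
    rcases Int.isUnit_iff.1 h3 with h | h <;> simp [h]
  · obtain ⟨x, hx0, hx⟩ := exists_reducedIncidence_mulVec_eq_zero G r s hc
    have h3 : N.det = 0 := by
      rw [← Matrix.exists_mulVec_eq_zero_iff]
      refine ⟨x ∘ e, ?_, ?_⟩
      · intro h
        apply hx0
        funext u
        simpa using congrFun h (e.symm u)
      · rw [hN, Matrix.submatrix_mulVec_equiv]
        simpa [Function.comp_assoc] using hx
    simp [h3]

/-! ### Matrix-tree theorem -/

variable [DecidableRel G.Adj]

/-- The weighted Laplacian matrix of `G` with the row and the column of `r` removed. -/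
noncomputable def reducedLaplacian (r : V) (f : G.edgeSet → ℝ) :
    Matrix {v // v ≠ r} {v // v ≠ r} ℝ :=
  ((reducedIncidence G r).map (Int.cast : ℤ → ℝ)).transpose *
    (Matrix.diagonal f * (reducedIncidence G r).map (Int.cast : ℤ → ℝ))

/-- The weighted **matrix-tree theorem**. -/
theorem det_reducedLaplacian (r : V) (f : G.edgeSet → ℝ) :
    (reducedLaplacian G r f).det = treeNumber G f := by
  classical
  have hcard : Fintype.card {v // v ≠ r} + 1 = Nat.card V := by
    rw [Nat.card_eq_fintype_card, Fintype.card_subtype_compl, Fintype.card_subtype_eq]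
    exact Nat.sub_add_cancel (Fintype.card_pos_iff.2 ⟨r⟩)
  -- Trees are the connected graphs with `|V| - 1` edges, which is the size of the minors in
  -- Cauchy–Binet.
  have htree : ∀ S : SimpleGraph V, S ≤ G → (S.IsTree ↔ S.Connected ∧
      (Finset.univ.filter fun e : G.edgeSet => e.1 ∈ S.edgeSet).card =
        Fintype.card {v // v ≠ r}) := by
    intro S hS
    have : (Finset.univ.filter fun e : G.edgeSet => e.1 ∈ S.edgeSet).card =
        Nat.card S.edgeSet := by
      rw [Nat.card_eq_fintype_card, Fintype.card, ← Finset.card_map ⟨_, Subtype.val_injective⟩,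
        ← Finset.card_map (s := (Finset.univ : Finset S.edgeSet)) ⟨_, Subtype.val_injective⟩]
      congr 1
      ext e
      simpa using fun h => SimpleGraph.edgeSet_mono hS h
    rw [SimpleGraph.isTree_iff_connected_and_card, this, ← hcard, add_left_inj]
  have hgraph : ∀ s : Finset G.edgeSet, ∀ e : G.edgeSet,
      e.1 ∈ (SimpleGraph.fromEdgeSet (Subtype.val '' (s : Set G.edgeSet))).edgeSet ↔ e ∈ s := by
    intro s e
    have := G.not_isDiag_of_mem_edgeSet e.2
    simp [SimpleGraph.edgeSet_fromEdgeSet, this]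
  have hle : ∀ s : Finset G.edgeSet,
      SimpleGraph.fromEdgeSet (Subtype.val '' (s : Set G.edgeSet)) ≤ G := by
    intro s
    rw [SimpleGraph.fromEdgeSet_le]
    rintro _ ⟨⟨e, _, rfl⟩, _⟩
    exact e.2
  have hinv : ∀ S : SimpleGraph V, S ≤ G →
      SimpleGraph.fromEdgeSet (Subtype.val ''
        ((Finset.univ.filter fun e : G.edgeSet => e.1 ∈ S.edgeSet : Finset G.edgeSet) :
          Set G.edgeSet)) = S := by
    intro S hS
    ext a b
    rw [SimpleGraph.fromEdgeSet_adj]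
    constructor
    · rintro ⟨⟨e, he, hee⟩, -⟩
      have he' : e.1 ∈ S.edgeSet := by simpa using he
      rwa [hee] at he'
    · intro h
      exact ⟨⟨⟨s(a, b), hS h⟩, by simpa using h, rfl⟩, h.ne⟩
  have hminor : ∀ s ∈ Finset.univ.powersetCard (Fintype.card {v // v ≠ r}),
      ((Matrix.diagonal f * (reducedIncidence G r).map (Int.cast : ℤ → ℝ) *
        ((reducedIncidence G r).map (Int.cast : ℤ → ℝ)).transpose).submatrix
          (Subtype.val : s → G.edgeSet) (Subtype.val : s → G.edgeSet)).det =
      if (SimpleGraph.fromEdgeSet (Subtype.val '' (s : Set G.edgeSet))).Connected then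
        ∏ e ∈ s, f e else 0 := by
    intro s hs
    have h0 := congrArg (Int.cast : ℤ → ℝ)
      (det_reducedIncidence_mul_transpose G r s (Finset.mem_powersetCard.1 hs).2)
    rw [Int.cast_det] at h0
    have h1 : (Matrix.diagonal f * (reducedIncidence G r).map (Int.cast : ℤ → ℝ) *
        ((reducedIncidence G r).map (Int.cast : ℤ → ℝ)).transpose).submatrix
          (Subtype.val : s → G.edgeSet) (Subtype.val : s → G.edgeSet) =
        Matrix.diagonal (fun e : s => f e) *
        ((reducedIncidence G r * (reducedIncidence G r).transpose).submatrix
          (Subtype.val : s → G.edgeSet) (Subtype.val : s → G.edgeSet)).map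
            (Int.cast : ℤ → ℝ) := by
      ext i j
      rw [Matrix.submatrix_apply, Matrix.mul_assoc, Matrix.diagonal_mul, Matrix.diagonal_mul]
      simp [Matrix.mul_apply]
    rw [h1, Matrix.det_mul, Matrix.det_diagonal, h0, Finset.prod_coe_sort s f]
    split_ifs <;> simp
  rw [reducedLaplacian, det_mul_eq_sum_minors, Finset.sum_congr rfl hminor, ← Finset.sum_filter,
    treeNumber]
  symm
  refine Finset.sum_bij'
    (fun S _ => Finset.univ.filter fun e : G.edgeSet => e.1 ∈ S.edgeSet)
    (fun s _ => SimpleGraph.fromEdgeSet (Subtype.val '' (s : Set G.edgeSet))) ?_ ?_ ?_ ?_ ?_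
  · intro S hS
    obtain ⟨hS, ht⟩ : S ≤ G ∧ S.IsTree := by simpa [spanningTrees] using hS
    have h := (htree S hS).1 ht
    rw [Finset.mem_filter, Finset.mem_powersetCard, hinv S hS]
    exact ⟨⟨Finset.subset_univ _, h.2⟩, h.1⟩
  · intro s hs
    rw [Finset.mem_filter, Finset.mem_powersetCard] at hs
    have h : SimpleGraph.fromEdgeSet (Subtype.val '' (s : Set G.edgeSet)) ≤ G ∧
        (SimpleGraph.fromEdgeSet (Subtype.val '' (s : Set G.edgeSet))).IsTree := by
      refine ⟨hle s, (htree _ (hle s)).2 ⟨hs.2, ?_⟩⟩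
      simp only [hgraph, Finset.filter_univ_mem, hs.1.2]
    simpa [spanningTrees] using h
  · intro S hS
    obtain ⟨hS, ht⟩ : S ≤ G ∧ S.IsTree := by simpa [spanningTrees] using hS
    exact hinv S hS
  · intro s _
    ext e
    simp only [Finset.mem_filter, Finset.mem_univ, true_and, hgraph]
  · intro S _
    rfl

/-! ### Critical points of the determinant -/

/-- The directional derivative of the determinant at the identity is the trace. -/
theorem hasDerivAt_det_one_add_smul {n : Type*} [Fintype n] [DecidableEq n] (M : Matrix n n ℝ) :
    HasDerivAt (fun t : ℝ => (1 + t • M).det) M.trace 0 := by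
  set p := (Matrix.det (1 + (Polynomial.X : Polynomial ℝ) • M.map Polynomial.C)).divX.divX with hp
  have h : (fun t : ℝ => (1 + t • M).det) = fun t => 1 + M.trace * t + p.eval t * t ^ 2 := by
    funext t
    exact Matrix.det_one_add_smul t M
  rw [h]
  have h1 := ((hasDerivAt_const (0 : ℝ) (1 : ℝ)).fun_add
    ((hasDerivAt_id (0 : ℝ)).const_mul M.trace)).fun_add
      ((p.hasDerivAt 0).fun_mul (hasDerivAt_pow 2 (0 : ℝ)))
  simpa using h1

open scoped MatrixOrder in
/-- The determinant of a positive semidefinite matrix `X` does not exceed that of a positive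
definite matrix `A` if the derivative of the determinant at `A` in the direction of `X`
vanishes. -/
theorem det_le_det_of_hasDerivAt_zero {n : Type*} [Fintype n] [DecidableEq n]
    {A X : Matrix n n ℝ} (hA : A.PosDef) (hX : X.PosSemidef)
    (h : HasDerivAt (fun t : ℝ => (A + t • (X - A)).det) 0 0) : X.det ≤ A.det := by
  obtain ⟨B, hB⟩ := CStarAlgebra.nonneg_iff_eq_star_mul_self.mp hA.posSemidef.nonneg
  rw [Matrix.star_eq_conjTranspose] at hB
  have hAdet := hA.det_pos
  have hBdet : IsUnit B.det := by
    rw [isUnit_iff_ne_zero]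
    intro h0
    rw [hB, Matrix.det_mul, h0, mul_zero] at hAdet
    exact hAdet.false
  have hBt : IsUnit B.conjTranspose.det := by
    rw [Matrix.det_conjTranspose]
    exact hBdet.star
  -- This congruence carries `A` to the identity and `X` to `Y`, so the hypothesis becomes `trace (Y
  -- - 1) = 0`.
  set Y := (B⁻¹).conjTranspose * X * B⁻¹ with hY
  have hYpos : Y.PosSemidef := hX.conjTranspose_mul_mul_same B⁻¹
  have hXY : X = B.conjTranspose * Y * B := by
    rw [hY, Matrix.conjTranspose_nonsing_inv]
    simp only [Matrix.mul_assoc]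
    rw [Matrix.nonsing_inv_mul _ hBdet, Matrix.mul_one, ← Matrix.mul_assoc,
      Matrix.mul_nonsing_inv _ hBt, Matrix.one_mul]
  have hdet : X.det = A.det * Y.det := by
    rw [hXY, hB]
    simp only [Matrix.det_mul]
    ring
  have hline : (fun t : ℝ => (A + t • (X - A)).det) =
      fun t => A.det * (1 + t • (Y - 1)).det := by
    funext t
    have : A + t • (X - A) = B.conjTranspose * (1 + t • (Y - 1)) * B := by
      rw [hXY, hB]
      simp only [Matrix.mul_add, Matrix.add_mul, Matrix.mul_smul, Matrix.smul_mul, Matrix.mul_sub,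
        Matrix.sub_mul, Matrix.mul_one]
    rw [this, hB]
    simp only [Matrix.det_mul]
    ring
  rw [hline] at h
  have htr := h.unique ((hasDerivAt_det_one_add_smul (Y - 1)).const_mul A.det)
  have htr0 : (Y - 1).trace = 0 := by
    rcases mul_eq_zero.1 htr.symm with h | h
    · exact absurd h hAdet.ne'
    · exact h
  have hYdet : Y.det ≤ 1 := by
    rw [hYpos.isHermitian.det_eq_prod_eigenvalues]
    rw [Matrix.trace_sub, hYpos.isHermitian.trace_eq_sum_eigenvalues, Matrix.trace_one] at htr0
    -- AM-GM for the eigenvalues, via `x ≤ exp (x - 1)`.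
    calc ∏ i, (hYpos.isHermitian.eigenvalues i : ℝ)
        ≤ ∏ i, Real.exp (hYpos.isHermitian.eigenvalues i - 1) := by
          refine Finset.prod_le_prod (fun i _ => hYpos.eigenvalues_nonneg i) fun i _ => ?_
          have := Real.add_one_le_exp (hYpos.isHermitian.eigenvalues i - 1)
          linarith
      _ = 1 := by
          rw [← Real.exp_sum, Finset.sum_sub_distrib, Real.exp_eq_one_iff]
          simpa using htr0
  rw [hdet]
  exact mul_le_of_le_one_right hAdet.le hYdet

end EdgeValuation

/-! ### First-order conditions -/

namespace EdgeValuation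

variable {V : Type*} [Fintype V] [DecidableEq V] (G : SimpleGraph V)

theorem sum_filter_mem_mk (a : V → ℝ) {v w : V} (h : v ≠ w) :
    ∑ u with u ∈ s(v, w), a u = a v + a w := by
  rw [← Finset.sum_pair h]
  refine Finset.sum_congr ?_ fun _ _ => rfl
  ext u
  simp

theorem eq_sum_of_vertex_function {f : G.edgeSet → ℝ} {g : V → ℝ}
    (hg : ∀ (v w : V) (h : G.Adj v w), f ⟨s(v, w), h⟩ = g v + g w) (e : G.edgeSet) :
    f e = ∑ v with v ∈ e.1, g v := by
  obtain ⟨e, he⟩ := e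
  induction e with
  | _ a b => rw [sum_filter_mem_mk _ (SimpleGraph.Adj.ne he), hg a b he]

variable [DecidableRel G.Adj]

theorem reducedLaplacian_add_smul_sub (r : V) (f f' : G.edgeSet → ℝ) (t : ℝ) :
    reducedLaplacian G r (f + t • (f' - f)) =
      reducedLaplacian G r f + t • (reducedLaplacian G r f' - reducedLaplacian G r f) := by
  have h : Matrix.diagonal (f + t • (f' - f)) =
      Matrix.diagonal f + t • (Matrix.diagonal f' - Matrix.diagonal f) := by
    rw [Matrix.diagonal_sub, ← Matrix.diagonal_smul, Matrix.diagonal_add]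
    rfl
  simp only [reducedLaplacian, h, Matrix.add_mul, Matrix.mul_add, Matrix.smul_mul, Matrix.mul_smul,
    Matrix.sub_mul, Matrix.mul_sub]

theorem reducedLaplacian_posSemidef (r : V) {f : G.edgeSet → ℝ} (hf : ∀ e, 0 < f e) :
    (reducedLaplacian G r f).PosSemidef := by
  have h := (Matrix.PosSemidef.diagonal (fun e => (hf e).le :
    (0 : G.edgeSet → ℝ) ≤ f)).conjTranspose_mul_mul_same
      ((reducedIncidence G r).map (Int.cast : ℤ → ℝ))
  rwa [Matrix.conjTranspose_eq_transpose_of_trivial, Matrix.mul_assoc] at h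

theorem hasDerivAt_treeNumber (f d : G.edgeSet → ℝ) :
    HasDerivAt (fun t : ℝ => treeNumber G (f + t • d)) (∑ e, d e * edgeTreeNumber G f e) 0 := by
  classical
  have h1 : ∀ e : G.edgeSet, HasDerivAt (fun t : ℝ => (f + t • d) e) (d e) 0 := by
    intro e
    simpa using ((hasDerivAt_id (0 : ℝ)).mul_const (d e)).const_add (f e)
  have h2 := HasDerivAt.fun_sum (u := spanningTrees G) fun S _ =>
    HasDerivAt.fun_finsetProd (u := Finset.univ.filter fun e : G.edgeSet => e.1 ∈ S.edgeSet)
      fun e _ => h1 e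
  refine h2.congr_deriv ?_
  simp only [edgeTreeNumber, Finset.mul_sum, Finset.sum_filter, zero_smul, add_zero, smul_eq_mul]
  rw [Finset.sum_comm]
  refine Finset.sum_congr rfl fun e _ => Finset.sum_congr rfl fun S _ => ?_
  split_ifs
  · rw [mul_comm]
    congr 1
    refine Finset.prod_congr ?_ fun _ _ => rfl
    ext k
    simp [and_comm]
  · rw [mul_zero]

/-- Without spanning trees both sides vanish. Otherwise the reduced Laplacian at `f` has nonzero
determinant, hence is positive definite. -/
theorem treeNumber_le_of_critical {f f' : G.edgeSet → ℝ} (hf : ∀ e, 0 < f e)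
    (hf' : ∀ e, 0 < f' e) (h : ∑ e, (f' - f) e * edgeTreeNumber G f e = 0) :
    treeNumber G f' ≤ treeNumber G f := by
  classical
  rcases (spanningTrees G).eq_empty_or_nonempty with he | hne
  · simp [treeNumber, he]
  · have hpos : 0 < treeNumber G f :=
      Finset.sum_pos (fun S _ => Finset.prod_pos fun e _ => hf e) hne
    obtain ⟨S, hS⟩ := hne
    have hS : S ≤ G ∧ S.IsTree := by simpa [spanningTrees] using hS
    obtain ⟨r⟩ := hS.2.connected.nonempty
    rw [← det_reducedLaplacian G r] at hpos ⊢
    rw [← det_reducedLaplacian G r]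
    refine det_le_det_of_hasDerivAt_zero
      ((reducedLaplacian_posSemidef G r hf).posDef_iff_det_ne_zero.2 hpos.ne')
      (reducedLaplacian_posSemidef G r hf') ?_
    have hd := hasDerivAt_treeNumber G f (f' - f)
    rw [h] at hd
    simpa only [← det_reducedLaplacian G r, reducedLaplacian_add_smul_sub] using hd

theorem critical_of_isMaxOn {A : Set (G.edgeSet → ℝ)} {f d : G.edgeSet → ℝ}
    (hmax : IsMaxOn (treeNumber G) A f) (hd : ∀ᶠ t in nhds (0 : ℝ), f + t • d ∈ A) :
    ∑ e, d e * edgeTreeNumber G f e = 0 := by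
  refine IsLocalMax.hasDerivAt_eq_zero (f := fun t : ℝ => treeNumber G (f + t • d)) (a := 0) ?_
    (hasDerivAt_treeNumber G f d)
  filter_upwards [hd] with t ht
  simpa using hmax ht

theorem eventually_pos_add_smul {ι : Type*} [Finite ι] {f : ι → ℝ} (hf : ∀ i, 0 < f i)
    (d : ι → ℝ) : ∀ᶠ t in nhds (0 : ℝ), ∀ i, 0 < (f + t • d) i := by
  rw [Filter.eventually_all]
  intro i
  have hc : Continuous fun t : ℝ => (f + t • d) i := by
    simp only [Pi.add_apply, Pi.smul_apply]
    fun_prop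
  exact hc.continuousAt.eventually (lt_mem_nhds (by simpa using hf i))

theorem sum_mul_sum_incident (a : V → ℝ) (x : G.edgeSet → ℝ) :
    ∑ v, a v * ∑ e : G.edgeSet with v ∈ e.1, x e = ∑ e, (∑ v with v ∈ e.1, a v) * x e := by
  simp only [Finset.mul_sum, Finset.sum_mul, Finset.sum_filter, mul_ite, ite_mul, mul_zero,
    zero_mul]
  rw [Finset.sum_comm]

theorem sum_incident_one (v : V) :
    ∑ e : G.edgeSet with v ∈ e.1, (1 : ℝ) = (G.degree v : ℝ) := by
  rw [Finset.sum_const, nsmul_eq_mul, mul_one, ← G.card_incidenceFinset_eq_degree,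
    ← Finset.card_map (⟨Subtype.val, Subtype.val_injective⟩ : G.edgeSet ↪ Sym2 V)]
  congr 2
  ext e
  simp [SimpleGraph.incidenceSet, and_comm]

theorem sum_degree_mul (a : V → ℝ) :
    ∑ v, a v * (G.degree v : ℝ) = ∑ e : G.edgeSet, ∑ v with v ∈ e.1, a v := by
  simp only [← sum_incident_one, sum_mul_sum_incident, mul_one]

/-- Every edge has two ends, so the vertex sums add up to twice the total weight. -/
theorem sum_eq_zero_of_sum_incident_eq_zero {d : G.edgeSet → ℝ}
    (hd : ∀ v, ∑ e : G.edgeSet with v ∈ e.1, d e = 0) : ∑ e, d e = 0 := by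
  have h := sum_mul_sum_incident G (fun _ => 1) d
  have h2 : ∀ e : G.edgeSet, ∑ v with v ∈ e.1, (1 : ℝ) = 2 := by
    rintro ⟨e, he⟩
    induction e with
    | _ a b =>
      rw [sum_filter_mem_mk _ (SimpleGraph.Adj.ne he)]
      norm_num
  simp only [hd, mul_zero, Finset.sum_const_zero, h2, ← Finset.mul_sum] at h
  linarith

/-! ### The two characterizations -/

theorem isMaxOn_T_iff {f : G.edgeSet → ℝ} (hf : f ∈ T G) :
    IsMaxOn (treeNumber G) (T G) f ↔
      ∃ l : V → ℝ, ∀ (v w : V) (h : G.Adj v w), edgeTreeNumber G f ⟨s(v, w), h⟩ = l v + l w := by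
  constructor
  · intro hmax
    let L : V → (G.edgeSet → ℝ) →ₗ[ℝ] ℝ := fun v =>
      ∑ e : G.edgeSet with v ∈ e.1, LinearMap.proj e
    let K : (G.edgeSet → ℝ) →ₗ[ℝ] ℝ := ∑ e, edgeTreeNumber G f e • LinearMap.proj e
    have hL : ∀ v d, L v d = ∑ e : G.edgeSet with v ∈ e.1, d e := fun v d => by simp [L]
    have hK : ∀ d, K d = ∑ e, edgeTreeNumber G f e * d e := fun d => by simp [K]
    -- Lagrange multipliers: the gradient vanishes on the common kernel of the vertex sums, so it is
    -- a combination of them, with coefficients `l`.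
    have hspan : K ∈ Submodule.span ℝ (Set.range L) := by
      refine FiniteDimensional.mem_span_of_iInf_ker_le_ker fun d hd => ?_
      simp only [Submodule.mem_iInf, LinearMap.mem_ker, hL] at hd
      rw [LinearMap.mem_ker, hK]
      have h0 := critical_of_isMaxOn G hmax (d := d) ?_
      · simpa only [mul_comm] using h0
      · filter_upwards [eventually_pos_add_smul hf.1.1 d] with t ht
        refine ⟨⟨ht, ?_⟩, fun v => ?_⟩
        · simp [Finset.sum_add_distrib, ← Finset.mul_sum, hf.1.2,
            sum_eq_zero_of_sum_incident_eq_zero G hd]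
        · simp [Finset.sum_add_distrib, ← Finset.mul_sum, hf.2 v, hd v]
    obtain ⟨l, hl⟩ := (Submodule.mem_span_range_iff_exists_fun ℝ).1 hspan
    refine ⟨l, fun v w h => ?_⟩
    have h1 := LinearMap.congr_fun hl (Pi.single ⟨s(v, w), h⟩ 1)
    rw [hK] at h1
    simp only [LinearMap.sum_apply, LinearMap.smul_apply, hL, smul_eq_mul,
      sum_mul_sum_incident] at h1
    simp only [Pi.single_apply, mul_ite, mul_one, mul_zero, Finset.sum_ite_eq',
      Finset.mem_univ, if_true] at h1
    rw [← h1, sum_filter_mem_mk _ h.ne]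
  · rintro ⟨l, hl⟩ f' hf'
    refine treeNumber_le_of_critical G hf.1.1 hf'.1.1 ?_
    have h1 := sum_mul_sum_incident G l (f' - f)
    have h2 : ∀ e : G.edgeSet, ∑ v with v ∈ e.1, l v = edgeTreeNumber G f e := by
      rintro ⟨e, he⟩
      induction e with
      | _ a b => rw [sum_filter_mem_mk _ (SimpleGraph.Adj.ne he), hl a b he]
    simp only [Pi.sub_apply, Finset.sum_sub_distrib, hf.2, hf'.2, sub_self, mul_zero,
      Finset.sum_const_zero, h2] at h1
    rw [h1]
    exact Finset.sum_congr rfl fun e _ => mul_comm _ _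

theorem isMaxOn_C_iff {f : G.edgeSet → ℝ} (hf : f ∈ C G) :
    IsMaxOn (treeNumber G) (C G) f ↔
      ∀ v w : V,
        (G.degree w : ℝ) * ∑ e : G.edgeSet with v ∈ e.1, edgeTreeNumber G f e =
          (G.degree v : ℝ) * ∑ e : G.edgeSet with w ∈ e.1, edgeTreeNumber G f e := by
  obtain ⟨hfP, g, hg, hfg⟩ := hf
  have hfg' := eq_sum_of_vertex_function G hfg
  constructor
  · intro hmax v w
    have key : ∀ a : V → ℝ, ∑ u, a u * (G.degree u : ℝ) = 0 →
        ∑ u, a u * ∑ e : G.edgeSet with u ∈ e.1, edgeTreeNumber G f e = 0 := by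
      intro a ha
      rw [sum_degree_mul] at ha
      rw [sum_mul_sum_incident]
      refine critical_of_isMaxOn G hmax (d := fun e => ∑ v with v ∈ e.1, a v) ?_
      filter_upwards [eventually_pos_add_smul hg a,
        eventually_pos_add_smul hfP.1 (fun e => ∑ v with v ∈ e.1, a v)] with t ht ht'
      refine ⟨⟨ht', ?_⟩, g + t • a, ht, fun x y h => ?_⟩
      · simp only [Pi.add_apply, Pi.smul_apply, smul_eq_mul, Finset.sum_add_distrib,
          ← Finset.mul_sum, ha, hfP.2, mul_zero, add_zero]
      · simp only [Pi.add_apply, Pi.smul_apply, smul_eq_mul, hfg x y h, sum_filter_mem_mk a h.ne]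
        ring
    -- This combination of the unit vectors at `v` and `w` is orthogonal to the degrees.
    have h := key (Pi.single v (G.degree w : ℝ) - Pi.single w (G.degree v : ℝ)) (by
      simp [sub_mul, Finset.sum_sub_distrib, Pi.single_apply, mul_comm])
    simp only [Pi.sub_apply, sub_mul, Finset.sum_sub_distrib, Pi.single_apply, ite_mul, zero_mul,
      Finset.sum_ite_eq', Finset.mem_univ, if_true] at h
    linarith
  · rintro h f' ⟨hfP', g', -, hfg₁⟩
    have hfg₁' := eq_sum_of_vertex_function G hfg₁
    refine treeNumber_le_of_critical G hfP.1 hfP'.1 ?_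
    have hd : ∀ e, (f' - f) e = ∑ v with v ∈ e.1, (g' - g) v := by
      intro e
      simp only [Pi.sub_apply, hfg' e, hfg₁' e, Finset.sum_sub_distrib]
    have h0 : ∑ v, (g' - g) v * (G.degree v : ℝ) = 0 := by
      rw [sum_degree_mul, ← Finset.sum_congr rfl fun e _ => hd e]
      simp only [Pi.sub_apply, Finset.sum_sub_distrib, hfP.2, hfP'.2, sub_self]
    rw [Finset.sum_congr rfl fun e _ => congrArg (· * _) (hd e), ← sum_mul_sum_incident]
    -- A vertex `w` of nonzero degree makes all the vertex sums of the gradient proportional to the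
    -- degrees.
    by_cases hdeg : ∃ w, (G.degree w : ℝ) ≠ 0
    · obtain ⟨w, hw⟩ := hdeg
      refine (mul_eq_zero.1 ?_).resolve_left hw
      calc (G.degree w : ℝ) * ∑ v, (g' - g) v *
            ∑ e : G.edgeSet with v ∈ e.1, edgeTreeNumber G f e
          = (∑ v, (g' - g) v * (G.degree v : ℝ)) *
            ∑ e : G.edgeSet with w ∈ e.1, edgeTreeNumber G f e := by
            rw [Finset.mul_sum, Finset.sum_mul]
            refine Finset.sum_congr rfl fun v _ => ?_
            rw [mul_left_comm, h v w, mul_assoc]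
        _ = 0 := by rw [h0, zero_mul]
    · push Not at hdeg
      have hempty : IsEmpty G.edgeSet := by
        refine ⟨fun ⟨e, he⟩ => ?_⟩
        induction e with
        | _ a b =>
          have := (G.degree_pos_iff_exists_adj a).2 ⟨b, he⟩
          exact this.ne' (by exact_mod_cast hdeg a)
      simp

end EdgeValuation

theorem theorem8 {V : Type*} [Fintype V] [DecidableEq V] (G : SimpleGraph V)
    [DecidableRel G.Adj] :
    (∀ f ∈ EdgeValuation.T G,
      (IsMaxOn (EdgeValuation.treeNumber G) (EdgeValuation.T G) f ↔
        ∃ l : V → ℝ, ∀ (v w : V) (h : G.Adj v w),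
          EdgeValuation.edgeTreeNumber G f ⟨s(v, w), h⟩ = l v + l w)) ∧
    (∀ f ∈ EdgeValuation.C G,
      (IsMaxOn (EdgeValuation.treeNumber G) (EdgeValuation.C G) f ↔
        ∀ v w : V,
          (G.degree w : ℝ) * ∑ e : G.edgeSet with v ∈ e.1, EdgeValuation.edgeTreeNumber G f e =
            (G.degree v : ℝ) *
              ∑ e : G.edgeSet with w ∈ e.1, EdgeValuation.edgeTreeNumber G f e)) :=
  ⟨fun _ hf => EdgeValuation.isMaxOn_T_iff G hf, fun _ hf => EdgeValuation.isMaxOn_C_iff G hf⟩
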